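/- Let $\mathcal X,\mathcal Y$ be compact metric spaces, let $\mathcal H_X,\mathcal H_Y$ be reproducing kernel Hilbert spaces of real functions on $\mathcal X,\mathcal Y$ with kernels $K,L$, and assume: $(\mathscr A_1)$ $\sup_{\mathcal X^2}K<\infty$ and $\sup_{\mathcal Y^2}L<\infty$; $(\mathscr A_2)$ $\mathcal H_X$ and $\mathcal H_Y$ are universal, i.e. $K$, $L$ are continuous and $\mathcal H_X$, $\mathcal H_Y$ are dense in $C(\mathcal X)$, $C(\mathcal Y)$ for the uniform norm. For $\gamma\in(0,1]$ and $r\ge 1$ let $(w_{i,r}(\gamma))_{1\le i\le r}$ be nonnegative numbers such that: $(\mathscr A_3)$ for each $\gamma$ there are $\tau>0$ and $n_0$ with $r\,\bigl|\frac1r\sum_{i=1}^r w_{i,r}(\gamma)-1\bigr|\le\tau$ for all $r>n_0$; $(\mathscr A_4)$ there is $C>0$ with $\max_{1\le i\le r}w_{i,r}(\gamma)<C$ for all $r\ge1$ and $\gamma\in(0,1]$; $(\mathscr A_5)$ for each $\gamma\in(0,1]$, $\lim_{r\to\infty}\frac1r\sum_{i=1}^r w_{i,r}(\gamma)^2=w(\gamma)^2>1$.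 Let $X,Y$ be random variables on a probability space $(\Omega,\mathscr A,\mathbb P)$ with values in $\mathcal X,\mathcal Y$, and let $(X_i,Y_i)_{i\ge1}$ be i.i.d. with the law of $(X,Y)$. Write $(g\otimes f)(h)=\langle g,h\rangle f$ and $m_X=\mathbb E K(X,\cdot)$, $m_Y=\mathbb E L(Y,\cdot)$, $\mu=\mathbb E\bigl(L(Y,\cdot)\otimes K(X,\cdot)\bigr)$, $\nu=m_Y\otimes m_X$, $\boldsymbol H=\|\mu-\nu\|_{\rm HS}^2$, $$\mathcal U(x,y)=\langle L(y,\cdot)\otimes K(x,\cdot)-\mu,\mu\rangle_{\rm HS}+\langle L(y,\cdot)\otimes m_X+m_Y\otimes K(x,\cdot)-2\nu,\nu-\mu\rangle_{\rm HS},\qquad \mathcal V(x,y)=\langle L(y,\cdot)\otimes K(x,\cdot)-\mu,\nu\rangle_{\rm HS},$$ where HS refers to the Hilbert–Schmidt norm and inner product, and, with $k_{ij}=K(X_i,X_j)$ and $\ell_{ij}=L(Y_i,Y_j)$, $$\widehat{\boldsymbol H}_{n,\gamma}=\frac1{n^2}\sum_{i,j=1}^n k_{ij}\ell_{ij}+\frac1{n^4}\sum_{i,j,q,r=1}^n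 k_{ij}\ell_{qr}-\frac2{n^3}\sum_{i,j,q=1}^n w_{i,n}(\gamma)\,k_{ij}\ell_{iq}.$$ Assume $\mathscr H_0$: $\mathbb P_{XY}=\mathbb P_X\times\mathbb P_Y$. Then $\boldsymbol H=0$, $\mu=\nu$, $\mathcal U=\mathcal V$, and for every $\gamma\in(0,1]$, as $n\to\infty$, $$\sqrt n\,\widehat{\boldsymbol H}_{n,\gamma}\;\xrightarrow{\ \mathscr D\ }\;\mathcal N(0,\sigma_\gamma^2),\qquad \sigma_\gamma^2=4\,(w(\gamma)^2-1)\,\mathrm{Var}\bigl(\mathcal V(X_1,Y_1)\bigr),$$ where $\mathcal N(0,0)$ denotes the Dirac mass at $0$. -/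

import Mathlib

open MeasureTheory ProbabilityTheory Filter Topology

noncomputable section

namespace HSIC

section RKHS

variable {𝒳 : Type*} (H : Type*) [NormedAddCommGroup H] [InnerProductSpace ℝ H] [CompleteSpace H]
  [RKHS ℝ H 𝒳 ℝ]

/-- The element `K(x, ·)` of the reproducing kernel Hilbert space `H` of real functions on `𝒳`;
it satisfies `⟪K(x, ·), f⟫ = f x` for all `f` in `H` (`RKHS.kerFun_inner`). -/
def feature (x : 𝒳) : H := RKHS.kerFun H x (1 : ℝ)

/-- The real-valued reproducing kernel `K(x, y)` of `H`. -/
def kern (x y : 𝒳) : ℝ := RKHS.kernel H x y (1 : ℝ)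

/-- The kernel is bounded above: `sup K < ∞`. -/
def KernelBounded : Prop := BddAbove (Set.range fun p : 𝒳 × 𝒳 => kern H p.1 p.2)

/-- A reproducing kernel Hilbert space is universal if its kernel is continuous and if it is
dense, for the uniform norm, in the space of continuous functions (on a compact space). -/
def Universal [TopologicalSpace 𝒳] [CompactSpace 𝒳] : Prop :=
  Continuous (fun p : 𝒳 × 𝒳 => kern H p.1 p.2) ∧
    Dense {g : C(𝒳, ℝ) | ∃ f : H, ∀ x, g x = f x}

/-- The kernel mean embedding `m_X = E[K(X, ·)]` of a random variable `X`. -/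
def meanEmb {Ω : Type*} [MeasurableSpace Ω] (P : Measure Ω) (X : Ω → 𝒳) : H :=
  ∫ ω, feature H (X ω) ∂P

end RKHS

section HilbertSchmidt

variable {F G : Type*} [NormedAddCommGroup F] [InnerProductSpace ℝ F]
  [NormedAddCommGroup G] [InnerProductSpace ℝ G]

/-- The tensor product `g ⊗ f`, that is, the operator `h ↦ ⟪g, h⟫ f` from `G` to `F`. -/
def tensorOp (g : G) (f : F) : G →L[ℝ] F := InnerProductSpace.rankOne ℝ f g

/-- The index set of a chosen Hilbert basis of `G`. -/
def basisSet (G : Type*) [NormedAddCommGroup G] [InnerProductSpace ℝ G] [CompleteSpace G] :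
    Set G :=
  (exists_hilbertBasis ℝ G).choose

/-- A chosen Hilbert basis of `G`. -/
def hilbBasis (G : Type*) [NormedAddCommGroup G] [InnerProductSpace ℝ G] [CompleteSpace G] :
    HilbertBasis (basisSet G) ℝ G :=
  (exists_hilbertBasis ℝ G).choose_spec.choose

/-- The Hilbert–Schmidt inner product `∑ i, ⟪A eᵢ, B eᵢ⟫` of Hilbert–Schmidt operators, where
`(eᵢ)` is a Hilbert basis of `G` (the value does not depend on the basis). -/
def hsInner [CompleteSpace G] (A B : G →L[ℝ] F) : ℝ :=
  ∑' i, inner ℝ (A (hilbBasis G i)) (B (hilbBasis G i))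

end HilbertSchmidt

section Population

variable {𝒳 𝒴 : Type*}
  (HX : Type*) [NormedAddCommGroup HX] [InnerProductSpace ℝ HX] [CompleteSpace HX]
  [RKHS ℝ HX 𝒳 ℝ]
  (HY : Type*) [NormedAddCommGroup HY] [InnerProductSpace ℝ HY] [CompleteSpace HY]
  [RKHS ℝ HY 𝒴 ℝ]
  {Ω : Type*} [MeasurableSpace Ω] (P : Measure Ω) (X : Ω → 𝒳) (Y : Ω → 𝒴)

/-- `μ = E[L(Y, ·) ⊗ K(X, ·)]`. -/
def muOp : HY →L[ℝ] HX := ∫ ω, tensorOp (feature HY (Y ω)) (feature HX (X ω)) ∂P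

/-- `ν = m_Y ⊗ m_X`. -/
def nuOp : HY →L[ℝ] HX := tensorOp (meanEmb HY P Y) (meanEmb HX P X)

/-- The Hilbert–Schmidt independence criterion `‖μ - ν‖²` (Hilbert–Schmidt norm). -/
def hsic : ℝ :=
  hsInner (muOp HX HY P X Y - nuOp HX HY P X Y) (muOp HX HY P X Y - nuOp HX HY P X Y)

/-- `U(x,y) = ⟪L(y,·) ⊗ K(x,·) - μ, μ⟫ + ⟪L(y,·) ⊗ m_X + m_Y ⊗ K(x,·) - 2ν, ν - μ⟫`. -/
def funU (x : 𝒳) (y : 𝒴) : ℝ :=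
  hsInner (tensorOp (feature HY y) (feature HX x) - muOp HX HY P X Y) (muOp HX HY P X Y)
    + hsInner
        (tensorOp (feature HY y) (meanEmb HX P X) + tensorOp (meanEmb HY P Y) (feature HX x)
          - (2 : ℝ) • nuOp HX HY P X Y)
        (nuOp HX HY P X Y - muOp HX HY P X Y)

/-- `V(x,y) = ⟪L(y,·) ⊗ K(x,·) - μ, ν⟫`. -/
def funV (x : 𝒳) (y : 𝒴) : ℝ :=
  hsInner (tensorOp (feature HY y) (feature HX x) - muOp HX HY P X Y) (nuOp HX HY P X Y)

end Population

/-- The modified estimator of the criterion computed from a sample `(x i, y i)` of size `n`, with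
weights `w i`. -/
def modHSIC {𝒳 𝒴 : Type*}
    (HX : Type*) [NormedAddCommGroup HX] [InnerProductSpace ℝ HX] [CompleteSpace HX]
    [RKHS ℝ HX 𝒳 ℝ]
    (HY : Type*) [NormedAddCommGroup HY] [InnerProductSpace ℝ HY] [CompleteSpace HY]
    [RKHS ℝ HY 𝒴 ℝ]
    {n : ℕ} (w : Fin n → ℝ) (x : Fin n → 𝒳) (y : Fin n → 𝒴) : ℝ :=
  1 / (n : ℝ) ^ 2 * ∑ i, ∑ j, kern HX (x i) (x j) * kern HY (y i) (y j)
    + 1 / (n : ℝ) ^ 4 * ∑ i, ∑ j, ∑ q, ∑ r, kern HX (x i) (x j) * kern HY (y q) (y r)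
    - 2 / (n : ℝ) ^ 3 * ∑ i, ∑ j, ∑ q, w i * (kern HX (x i) (x j) * kern HY (y i) (y q))

end HSIC

end

open HSIC

/-!
Write `f i = K(Xᵢ, ·)`, `g i = L(Yᵢ, ·)`, with means `m = m_X`, `m' = m_Y`. Under independence the
bilinearity of `⊗` gives `μ = ν` (`integral_tensorOp_prod`), which makes `H` vanish and `U` equal `V`.
By Parseval (`hsInner_tensorOp_sub`), `V(x, y) = ⟪K(x, ·), m⟫ ⟪L(y, ·), m'⟫ - ‖m‖² ‖m'‖²`, a bounded
function, centred under the product law.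

For the limit law, the three sums of the estimator are a squared norm of an average of tensors
`f i ⊗ₜ g i`, a product of squared norms of averages, and a weighted average. Expanding each around
the means, the contributions which are linear in the averages of `f i - m` and of `g i - m'` cancel,
up to the defect of the average weight from `1` and to products of two centred averages. What
remains is the linear statistic `2 / n * ∑ i, (1 - w i) * V(Xᵢ, Yᵢ)`; this deterministic statement is
`abs_featureHSIC_sub_le`. The cancellation in the weighted term uses that `⟪g i, m'⟫ f i` has mean
`‖m'‖² m`, which is where independence enters.

The remainder is controlled by squared norms of averages of independent centred vectors, whose means
are `O(1 / n)` (`integral_norm_sq_weighted_average_le`), so after multiplication by `√n` it tends to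
`0` in probability. The linear statistic obeys the central limit theorem with weights `2 (1 - w i)`
(`tendstoInDistribution_weighted_sum`), whose mean square tends to `4 (w(γ)² - 1)`. Both facts are
combined in `tendstoInDistribution_featureHSIC`.

The tensors are taken in Mathlib's inner product space `F ⊗[ℝ] G`; it is not complete, but only
finite sums in it are needed. -/

namespace HSIC

section

open scoped TensorProduct

/-! ### Central limit theorem for weighted sums -/

/-- Telescoping bound for products of complex numbers in the unit disc. -/
theorem norm_prod_sub_prod_le_sum {ι : Type*} (s : Finset ι) (a b : ι → ℂ)
    (ha : ∀ i ∈ s, ‖a i‖ ≤ 1) (hb : ∀ i ∈ s, ‖b i‖ ≤ 1) :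
    ‖∏ i ∈ s, a i - ∏ i ∈ s, b i‖ ≤ ∑ i ∈ s, ‖a i - b i‖ := by
  classical
  induction s using Finset.induction_on with
  | empty => simp
  | insert j s hj ih =>
    rw [Finset.prod_insert hj, Finset.prod_insert hj, Finset.sum_insert hj]
    have ih' := ih (fun i hi => ha i (Finset.mem_insert_of_mem hi))
      (fun i hi => hb i (Finset.mem_insert_of_mem hi))
    have haj := ha j (Finset.mem_insert_self j s)
    have hbs : ‖∏ i ∈ s, b i‖ ≤ 1 := by
      rw [norm_prod]
      exact Finset.prod_le_one (fun i _ => norm_nonneg _)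
        (fun i hi => hb i (Finset.mem_insert_of_mem hi))
    calc ‖a j * ∏ i ∈ s, a i - b j * ∏ i ∈ s, b i‖
        = ‖(a j - b j) * ∏ i ∈ s, b i + a j * (∏ i ∈ s, a i - ∏ i ∈ s, b i)‖ := by
          congr 1; ring
      _ ≤ ‖a j - b j‖ * ‖∏ i ∈ s, b i‖ + ‖a j‖ * ‖∏ i ∈ s, a i - ∏ i ∈ s, b i‖ := by
          refine (norm_add_le _ _).trans ?_
          rw [norm_mul, norm_mul]
      _ ≤ ‖a j - b j‖ * 1 + 1 * ∑ i ∈ s, ‖a i - b i‖ := by gcongr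
      _ = _ := by ring

/-- Second-order Taylor expansion of the characteristic function of a centred law. -/
theorem charFun_isLittleO_of_centered {P : Measure ℝ} [IsProbabilityMeasure P]
    (hP : MemLp id 2 P) (h0 : ∫ x, x ∂P = 0) :
    (fun t : ℝ => charFun P t - (1 - ((∫ x, x ^ 2 ∂P : ℝ) : ℂ) * t ^ 2 / 2)) =o[𝓝 0]
      fun t : ℝ => t ^ 2 := by
  have key := taylor_isLittleO_univ (x₀ := (0 : ℝ)) (n := 2) (f := charFun P)
    (contDiff_charFun hP)
  have hT : ∀ t : ℝ, taylorWithinEval (charFun P) 2 Set.univ 0 t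
      = 1 - ((∫ x, x ^ 2 ∂P : ℝ) : ℂ) * t ^ 2 / 2 := by
    intro t
    have h := taylorWithinEval_charFun_two_zero (P := P) (X := id) aemeasurable_id
      (by simpa using hP) t
    simp only [Measure.map_id, id_eq, Pi.pow_apply] at h
    rw [h, h0]
    simp
  simp_rw [hT] at key
  simpa using key

theorem cexp_neg_sq_isLittleO (v : ℝ) :
    (fun t : ℝ => Complex.exp (-((v : ℂ) * t ^ 2 / 2)) - (1 - (v : ℂ) * t ^ 2 / 2)) =o[𝓝 0]
      fun t : ℝ => t ^ 2 := by
  have h := (Complex.hasDerivAt_exp 0).isLittleO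
  have ht : Tendsto (fun t : ℝ => -((v : ℂ) * t ^ 2 / 2)) (𝓝 0) (𝓝 0) := by
    have : Continuous (fun t : ℝ => -((v : ℂ) * t ^ 2 / 2)) := by fun_prop
    simpa using this.tendsto 0
  have h2 := h.comp_tendsto ht
  refine Asymptotics.IsLittleO.trans_isBigO (g := fun t : ℝ => -((v : ℂ) * t ^ 2 / 2)) ?_ ?_
  · refine (h2.congr ?_ ?_)
    · intro t; simp; ring
    · intro t; simp
  · refine Asymptotics.IsBigO.of_bound (|v| / 2) (Eventually.of_forall fun t => ?_)
    simp
    apply le_of_eq; ring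

/-- Central limit theorem for weighted sums of i.i.d. centred square-integrable variables, with a
triangular array of uniformly bounded weights. The characteristic function of the sum is the product
of the values `φ (c n i / √n * t)`. The function `φ` agrees with its Gaussian counterpart up to
`o(u²)` at `0`, uniformly in `i` since the weights are bounded, and the Gaussian product depends on
the weights only through the average of their squares. -/
theorem tendstoInDistribution_weighted_sum {Ω : Type*} [MeasurableSpace Ω] {P : Measure Ω}
    [IsProbabilityMeasure P] {ξ : ℕ → Ω → ℝ} (hindep : iIndepFun ξ P)
    (hident : ∀ i, IdentDistrib (ξ i) (ξ 0) P P) (hL2 : MemLp (ξ 0) 2 P) (h0 : P[ξ 0] = 0)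
    {c : (n : ℕ) → Fin n → ℝ} {C : ℝ} (hc : ∀ n i, |c n i| ≤ C) {s : ℝ} (hs : 0 ≤ s)
    (hlim : Tendsto (fun n : ℕ => 1 / (n : ℝ) * ∑ i, c n i ^ 2) atTop (𝓝 s)) :
    TendstoInDistribution (fun (n : ℕ) ω => ∑ i : Fin n, c n i / √n * ξ i ω) atTop
      (id : ℝ → ℝ) (fun _ => P) (gaussianReal 0 (Real.toNNReal (s * variance (ξ 0) P))) := by
  have hm : ∀ i, AEMeasurable (ξ i) P := fun i => (hident i).aemeasurable_fst
  set Q := P.map (ξ 0) with hQ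
  have : IsProbabilityMeasure Q := Measure.isProbabilityMeasure_map (hm 0)
  set v := variance (ξ 0) P with hv
  have hv0 : 0 ≤ v := variance_nonneg _ _
  have hQ2 : MemLp id 2 Q := by
    rw [hQ, memLp_map_measure_iff (by fun_prop) (hm 0)]
    exact hL2
  have hQ0 : ∫ x, x ∂Q = 0 := by
    rw [hQ, integral_map (hm 0) (by fun_prop)]; exact h0
  have hQv : ∫ x, x ^ 2 ∂Q = v := by
    rw [hQ, integral_map (hm 0) (by fun_prop), hv, variance_of_integral_eq_zero (hm 0) h0]
  have hdiff : (fun t : ℝ => charFun Q t - Complex.exp (-((v : ℂ) * t ^ 2 / 2))) =o[𝓝 0]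
      fun t : ℝ => t ^ 2 := by
    have h1 := charFun_isLittleO_of_centered hQ2 hQ0
    rw [hQv] at h1
    refine (h1.sub (cexp_neg_sq_isLittleO v)).congr_left fun t => ?_
    ring
  have hmeas : ∀ n : ℕ, AEMeasurable (fun ω => ∑ i : Fin n, c n i / √n * ξ i ω) P := fun n =>
    Finset.aemeasurable_fun_sum _ fun i _ => (hm i).const_mul _
  refine ⟨hmeas, by fun_prop, ?_⟩
  refine ProbabilityMeasure.tendsto_iff_tendsto_charFun.2 fun t => ?_
  simp only [ProbabilityMeasure.coe_mk, Measure.map_id, charFun_gaussianReal]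
  have hchar : ∀ n : ℕ, charFun (P.map (fun ω => ∑ i : Fin n, c n i / √n * ξ i ω)) t
      = ∏ i : Fin n, charFun Q (c n i / √n * t) := by
    intro n
    have hi : iIndepFun (fun (i : Fin n) ω => c n i / √n * ξ i ω) P :=
      (hindep.precomp Fin.val_injective).comp (fun i x => c n i / √n * x)
        (fun i => by fun_prop)
    rw [iIndepFun.charFun_map_fun_sum_eq_prod (X := fun (i : Fin n) ω => c n i / √n * ξ i ω)
      (fun i => (hm i).const_mul _) hi, Finset.prod_apply]
    refine Finset.prod_congr rfl fun i _ => ?_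
    rw [charFun_map_mul_comp (hm i), (hident i).map_eq]
  simp_rw [hchar]
  set E : ℕ → ℂ := fun n => ∏ i : Fin n,
    Complex.exp (-((v : ℂ) * ((c n i / √n * t : ℝ) : ℂ) ^ 2 / 2)) with hE
  have hElim : Tendsto E atTop (𝓝 (Complex.exp (t * (0 : ℝ) * Complex.I
      - (Real.toNNReal (s * v) : ℝ) * t ^ 2 / 2))) := by
    have hEeq : ∀ n, E n = Complex.exp
        (((-(v * t ^ 2 / 2 * (1 / (n : ℝ) * ∑ i, c n i ^ 2)) : ℝ)) : ℂ) := by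
      intro n
      rw [hE]
      simp only
      rw [← Complex.exp_sum]
      congr 1
      rw [Finset.mul_sum, Finset.mul_sum, ← Finset.sum_neg_distrib, Complex.ofReal_sum]
      refine Finset.sum_congr rfl fun i _ => ?_
      have : ((c n i / √n * t) ^ 2 : ℝ) = c n i ^ 2 * (1 / (n : ℝ)) * t ^ 2 := by
        rw [mul_pow, div_pow, Real.sq_sqrt (Nat.cast_nonneg n)]; ring
      rw [← Complex.ofReal_pow, this]
      push_cast; ring
    rw [funext hEeq]
    have h1 := (hlim.const_mul (v * t ^ 2 / 2)).neg
    have h2 := ((Complex.continuous_exp.comp Complex.continuous_ofReal).tendsto _).comp h1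
    refine h2.congr' ?_ |>.trans_eq ?_
    · exact Eventually.of_forall fun n => rfl
    · congr 1
      rw [Real.coe_toNNReal _ (mul_nonneg hs hv0), Function.comp_apply]
      congr 1
      push_cast
      ring
  -- Each of the `n` factors differs from its Gaussian counterpart by `o(1 / n)`.
  have hsub : Tendsto (fun n : ℕ => (∏ i : Fin n, charFun Q (c n i / √n * t)) - E n) atTop
      (𝓝 (0 : ℂ)) := by
    rw [Metric.tendsto_nhds]
    intro ε hε
    set ε' := ε / (t ^ 2 * (s + 1) + 1) with hε'
    have hden : 0 < t ^ 2 * (s + 1) + 1 := by positivity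
    have hε'0 : 0 < ε' := by positivity
    obtain ⟨δ, hδ, hball⟩ := Metric.eventually_nhds_iff.1 (hdiff.def hε'0)
    have hsmall : Tendsto (fun n : ℕ => (C * |t|) / √(n : ℝ)) atTop (𝓝 0) :=
      tendsto_const_nhds.div_atTop (Real.tendsto_sqrt_atTop.comp tendsto_natCast_atTop_atTop)
    filter_upwards [hsmall.eventually (gt_mem_nhds hδ), hlim.eventually (gt_mem_nhds (lt_add_one s))]
      with n hn1 hn2
    rw [dist_zero_right]
    have hexp : ∀ i : Fin n, ‖Complex.exp (-((v : ℂ) * ((c n i / √n * t : ℝ) : ℂ) ^ 2 / 2))‖ ≤ 1 := by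
      intro i
      rw [Complex.norm_exp, Real.exp_le_one_iff]
      have : (-((v : ℂ) * ((c n i / √n * t : ℝ) : ℂ) ^ 2 / 2))
          = ((-(v * (c n i / √n * t) ^ 2 / 2) : ℝ) : ℂ) := by push_cast; ring
      rw [this, Complex.ofReal_re]
      have : 0 ≤ v * (c n i / √n * t) ^ 2 / 2 := by positivity
      linarith
    calc ‖∏ i : Fin n, charFun Q (c n i / √n * t) - E n‖
        ≤ ∑ i : Fin n, ‖charFun Q (c n i / √n * t)
            - Complex.exp (-((v : ℂ) * ((c n i / √n * t : ℝ) : ℂ) ^ 2 / 2))‖ :=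
          norm_prod_sub_prod_le_sum _ _ _ (fun i _ => norm_charFun_le_one _) (fun i _ => hexp i)
      _ ≤ ∑ i : Fin n, ε' * (t ^ 2 * (1 / n * c n i ^ 2)) := by
          refine Finset.sum_le_sum fun i _ => ?_
          have hd : dist (c n i / √n * t) 0 < δ := by
            rw [dist_zero_right, Real.norm_eq_abs, abs_mul, abs_div, abs_of_nonneg (Real.sqrt_nonneg _)]
            calc |c n i| / √n * |t| = |c n i| * |t| / √n := by ring
              _ ≤ C * |t| / √n := by gcongr; exact hc n i
              _ < δ := hn1
          refine (hball hd).trans (le_of_eq ?_)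
          rw [Real.norm_eq_abs, abs_of_nonneg (sq_nonneg _), mul_pow, div_pow,
            Real.sq_sqrt (Nat.cast_nonneg n)]
          ring
      _ = ε' * (t ^ 2 * (1 / n * ∑ i, c n i ^ 2)) := by
          rw [← Finset.mul_sum, ← Finset.mul_sum, ← Finset.mul_sum]
      _ ≤ ε' * (t ^ 2 * (s + 1)) := by gcongr
      _ < ε' * (t ^ 2 * (s + 1) + 1) := by gcongr; linarith
      _ = ε := by rw [hε']; field_simp
  simpa using hsub.add hElim

/-! ### Second moments of weighted averages of centred vectors -/

/-- Second moment of a weighted sum of independent copies of a centred vector: the cross terms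
vanish. The space `E` need be neither complete nor separable, as centring and measurability are only
asked of the scalars `⟪F z, F z'⟫`; this allows `E` to be an algebraic tensor product. -/
theorem integral_norm_sq_weighted_sum_le {Ω 𝒵 E : Type*} [MeasurableSpace Ω] [MeasurableSpace 𝒵]
    [NormedAddCommGroup E] [InnerProductSpace ℝ E] {P : Measure Ω} [IsProbabilityMeasure P]
    {ρ : Measure 𝒵} [IsProbabilityMeasure ρ] {Z : ℕ → Ω → 𝒵} (hZ : ∀ i, Measurable (Z i))
    (hindep : iIndepFun Z P) (hlaw : ∀ i, P.map (Z i) = ρ) {F : 𝒵 → E} {M : ℝ}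
    (hF : Measurable fun p : 𝒵 × 𝒵 => (inner ℝ (F p.1) (F p.2) : ℝ)) (hM : ∀ z, ‖F z‖ ≤ M)
    (h0 : ∀ z, ∫ z', (inner ℝ (F z) (F z') : ℝ) ∂ρ = 0) {n : ℕ} {c : Fin n → ℝ} {C : ℝ}
    (hc : ∀ i, |c i| ≤ C) :
    Integrable (fun ω => ‖∑ i, c i • F (Z i ω)‖ ^ 2) P ∧
      ∫ ω, ‖∑ i, c i • F (Z i ω)‖ ^ 2 ∂P ≤ n * (C ^ 2 * M ^ 2) := by
  have hexp : ∀ ω, ‖∑ i, c i • F (Z i ω)‖ ^ 2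
      = ∑ i, ∑ j, c i * c j * inner ℝ (F (Z i ω)) (F (Z j ω)) := by
    intro ω
    rw [← real_inner_self_eq_norm_sq, sum_inner]
    refine Finset.sum_congr rfl fun i _ => ?_
    rw [inner_sum]
    refine Finset.sum_congr rfl fun j _ => ?_
    rw [real_inner_smul_left, real_inner_smul_right]; ring
  have hb : ∀ p : 𝒵 × 𝒵, ‖(inner ℝ (F p.1) (F p.2) : ℝ)‖ ≤ M * M := fun p =>
    (norm_inner_le_norm _ _).trans (mul_le_mul (hM _) (hM _) (norm_nonneg _)
      ((norm_nonneg _).trans (hM p.1)))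
  have hint : ∀ i j : ℕ, Integrable (fun ω => (inner ℝ (F (Z i ω)) (F (Z j ω)) : ℝ)) P :=
    fun i j => Integrable.of_bound
      (hF.comp ((hZ i).prodMk (hZ j))).aestronglyMeasurable (M * M)
      (Eventually.of_forall fun ω => hb (Z i ω, Z j ω))
  have hoff : ∀ i j : ℕ, i ≠ j → ∫ ω, (inner ℝ (F (Z i ω)) (F (Z j ω)) : ℝ) ∂P = 0 := by
    intro i j hij
    have hprod : P.map (fun ω => (Z i ω, Z j ω)) = ρ.prod ρ := by
      rw [(hindep.indepFun hij).map_prod_eq_prod_map_map (hZ i).aemeasurable (hZ j).aemeasurable,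
        hlaw, hlaw]
    rw [← integral_map (φ := fun ω => (Z i ω, Z j ω))
      (f := fun p : 𝒵 × 𝒵 => (inner ℝ (F p.1) (F p.2) : ℝ))
      ((hZ i).prodMk (hZ j)).aemeasurable hF.aestronglyMeasurable, hprod,
      integral_prod _ (Integrable.of_bound hF.aestronglyMeasurable (M * M)
        (Eventually.of_forall hb))]
    simp [h0]
  simp_rw [hexp]
  have hint' : ∀ i j : Fin n,
      Integrable (fun ω => c i * c j * (inner ℝ (F (Z i ω)) (F (Z j ω)) : ℝ)) P :=
    fun i j => (hint i j).const_mul _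
  refine ⟨integrable_finsetSum _ fun i _ => integrable_finsetSum _ fun j _ => hint' i j, ?_⟩
  rw [integral_finsetSum _ fun i _ => integrable_finsetSum _ fun j _ => hint' i j]
  have hrow : ∀ i : Fin n, ∫ ω, ∑ j, c i * c j * (inner ℝ (F (Z i ω)) (F (Z j ω)) : ℝ) ∂P
      ≤ C ^ 2 * M ^ 2 := by
    intro i
    rw [integral_finsetSum _ fun j _ => hint' i j, Finset.sum_eq_single i]
    · rw [integral_const_mul]
      have h1 : ∫ ω, (inner ℝ (F (Z i ω)) (F (Z i ω)) : ℝ) ∂P ≤ M ^ 2 := by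
        have := integral_mono (hint i i) (integrable_const (M ^ 2)) fun ω => by
          simpa [sq] using (le_abs_self _).trans (hb (Z i ω, Z i ω))
        simpa using this
      have h2 : 0 ≤ ∫ ω, (inner ℝ (F (Z i ω)) (F (Z i ω)) : ℝ) ∂P :=
        integral_nonneg fun ω => real_inner_self_nonneg
      have h3 : c i * c i ≤ C ^ 2 := by
        rw [← abs_mul_abs_self, sq]
        exact mul_self_le_mul_self (abs_nonneg _) (hc i)
      exact mul_le_mul h3 h1 h2 (sq_nonneg C)
    · intro j _ hji
      rw [integral_const_mul, hoff i j (fun h => hji (Fin.ext h.symm)), mul_zero]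
    · simp
  calc _ ≤ ∑ _i : Fin n, C ^ 2 * M ^ 2 := Finset.sum_le_sum fun i _ => hrow i
    _ = _ := by simp

theorem integral_norm_sq_weighted_average_le {Ω 𝒵 E : Type*} [MeasurableSpace Ω]
    [MeasurableSpace 𝒵] [NormedAddCommGroup E] [InnerProductSpace ℝ E] {P : Measure Ω}
    [IsProbabilityMeasure P] {ρ : Measure 𝒵} [IsProbabilityMeasure ρ] {Z : ℕ → Ω → 𝒵}
    (hZ : ∀ i, Measurable (Z i)) (hindep : iIndepFun Z P) (hlaw : ∀ i, P.map (Z i) = ρ)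
    {F : 𝒵 → E} {M : ℝ} (hF : Measurable fun p : 𝒵 × 𝒵 => (inner ℝ (F p.1) (F p.2) : ℝ))
    (hM : ∀ z, ‖F z‖ ≤ M) (h0 : ∀ z, ∫ z', (inner ℝ (F z) (F z') : ℝ) ∂ρ = 0) {n : ℕ}
    {c : Fin n → ℝ} {C : ℝ} (hc : ∀ i, |c i| ≤ C) :
    Integrable (fun ω => ‖(1 / (n : ℝ)) • ∑ i, c i • F (Z i ω)‖ ^ 2) P ∧
      ∫ ω, ‖(1 / (n : ℝ)) • ∑ i, c i • F (Z i ω)‖ ^ 2 ∂P ≤ C ^ 2 * M ^ 2 / n := by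
  obtain ⟨h1, h2⟩ := integral_norm_sq_weighted_sum_le hZ hindep hlaw hF hM h0 hc
  simp_rw [norm_smul, mul_pow, Real.norm_eq_abs, sq_abs]
  refine ⟨h1.const_mul _, ?_⟩
  rw [integral_const_mul]
  rcases Nat.eq_zero_or_pos n with rfl | hn
  · simp
  · have hn0 : (0 : ℝ) < n := Nat.cast_pos.2 hn
    calc (1 / (n : ℝ)) ^ 2 * ∫ ω, ‖∑ i, c i • F (Z i ω)‖ ^ 2 ∂P
        ≤ (1 / (n : ℝ)) ^ 2 * (n * (C ^ 2 * M ^ 2)) := by gcongr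
      _ = C ^ 2 * M ^ 2 / n := by field_simp

/-! ### Linearization of the estimator -/

section
variable {F G : Type*} [NormedAddCommGroup F] [InnerProductSpace ℝ F]
  [NormedAddCommGroup G] [InnerProductSpace ℝ G]

theorem sum_inner_mul_inner_eq_norm_sq_sum_tmul {n : ℕ} (f : Fin n → F) (g : Fin n → G) :
    ∑ i, ∑ j, inner ℝ (f i) (f j) * inner ℝ (g i) (g j) = ‖∑ i, f i ⊗ₜ[ℝ] g i‖ ^ 2 := by
  rw [← real_inner_self_eq_norm_sq, sum_inner]
  simp_rw [inner_sum, TensorProduct.inner_tmul]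

theorem sum_inner_eq_norm_sq_sum {n : ℕ} (f : Fin n → F) :
    ∑ i, ∑ j, (inner ℝ (f i) (f j) : ℝ) = ‖∑ i, f i‖ ^ 2 := by
  rw [← real_inner_self_eq_norm_sq, sum_inner]
  simp_rw [inner_sum]

/-- The estimator `HSIC.modHSIC`, written for arbitrary vectors `f i`, `g i` in place of the feature
vectors `K(xᵢ, ·)`, `L(yᵢ, ·)` and with inner products in place of kernels. -/
noncomputable def featureHSIC {n : ℕ} (w : Fin n → ℝ) (f : Fin n → F) (g : Fin n → G) : ℝ :=
  1 / (n : ℝ) ^ 2 * ∑ i, ∑ j, inner ℝ (f i) (f j) * inner ℝ (g i) (g j)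
    + 1 / (n : ℝ) ^ 4 * ∑ i, ∑ j, ∑ q, ∑ r, inner ℝ (f i) (f j) * inner ℝ (g q) (g r)
    - 2 / (n : ℝ) ^ 3 * ∑ i, ∑ j, ∑ q, w i * (inner ℝ (f i) (f j) * inner ℝ (g i) (g q))

/-- The three sums defining `featureHSIC` in terms of averages: the first is the squared norm of the
average tensor, the second the product of the squared norms of the average features. -/
theorem featureHSIC_eq {n : ℕ} (w : Fin n → ℝ) (f : Fin n → F) (g : Fin n → G) :
    featureHSIC w f g = ‖(1 / (n : ℝ)) • ∑ i, f i ⊗ₜ[ℝ] g i‖ ^ 2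
      + ‖(1 / (n : ℝ)) • ∑ i, f i‖ ^ 2 * ‖(1 / (n : ℝ)) • ∑ i, g i‖ ^ 2
      - 2 / n * ∑ i, w i * (inner ℝ (f i) ((1 / (n : ℝ)) • ∑ j, f j) *
          inner ℝ (g i) ((1 / (n : ℝ)) • ∑ q, g q)) := by
  have h2 : ∑ i, ∑ j, ∑ q, ∑ r, (inner ℝ (f i) (f j) : ℝ) * inner ℝ (g q) (g r)
      = ‖∑ i, f i‖ ^ 2 * ‖∑ i, g i‖ ^ 2 := by
    rw [← sum_inner_eq_norm_sq_sum f, ← sum_inner_eq_norm_sq_sum g]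
    simp_rw [Finset.sum_mul, Finset.mul_sum]
  have h3 : ∀ i, ∑ j, ∑ q, w i * ((inner ℝ (f i) (f j) : ℝ) * inner ℝ (g i) (g q))
      = w i * (inner ℝ (f i) (∑ j, f j) * inner ℝ (g i) (∑ q, g q)) := by
    intro i
    simp_rw [inner_sum, Finset.sum_mul, Finset.mul_sum]
  rw [featureHSIC, sum_inner_mul_inner_eq_norm_sq_sum_tmul, h2]
  simp_rw [h3, real_inner_smul_right, norm_smul, mul_pow, Real.norm_eq_abs, sq_abs, Finset.mul_sum]
  congr 1
  · ring
  · refine Finset.sum_congr rfl fun i _ => ?_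
    ring

theorem average_eq_add_average_sub {H : Type*} [AddCommGroup H] [Module ℝ H] {n : ℕ} (hn : n ≠ 0)
    (h : Fin n → H) (z : H) :
    (1 / (n : ℝ)) • ∑ i, h i = z + (1 / (n : ℝ)) • ∑ i, (h i - z) := by
  have hn0 : (n : ℝ) ≠ 0 := Nat.cast_ne_zero.2 hn
  rw [Finset.sum_sub_distrib, smul_sub, Finset.sum_const, Finset.card_univ, Fintype.card_fin,
    ← Nat.cast_smul_eq_nsmul ℝ, smul_smul, one_div, inv_mul_cancel₀ hn0, one_smul]
  abel

theorem norm_average_le {H : Type*} [NormedAddCommGroup H] [NormedSpace ℝ H] {n : ℕ} (hn : n ≠ 0)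
    {h : Fin n → H} {R : ℝ} (hR : ∀ i, ‖h i‖ ≤ R) : ‖(1 / (n : ℝ)) • ∑ i, h i‖ ≤ R := by
  have hn0 : (0 : ℝ) < n := Nat.cast_pos.2 (Nat.pos_of_ne_zero hn)
  rw [norm_smul, Real.norm_of_nonneg (by positivity), one_div, inv_mul_le_iff₀ hn0]
  calc ‖∑ i, h i‖ ≤ ∑ _i : Fin n, R := norm_sum_le_of_le _ fun i _ => hR i
    _ = n * R := by simp

/-- The scalar inequality behind `abs_featureHSIC_sub_le`. There `a`, `b` are the norms of the means,
`x`, `y` those of the centred feature averages, `p`, `q` the inner products of these averages with the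
means, `d` the norm of the centred tensor average, `gf`, `gg` those of the weighted averages, `r`, `t` the inner
products of the weighted averages with the centred ones, `S` the weighted average of products of
fluctuations, and `δ` the defect of the average weight from `1`. -/
theorem abs_remainder_le {M C a b x y p q gf gg r t S δ d : ℝ} (hM : 1 ≤ M) (hC : 0 ≤ C)
    (ha : 0 ≤ a) (hb : 0 ≤ b) (hx : 0 ≤ x) (hy : 0 ≤ y) (haM : a ≤ M) (hbM : b ≤ M)
    (hxM : x ≤ 2 * M) (hyM : y ≤ 2 * M) (hp : |p| ≤ M * x) (hq : |q| ≤ M * y)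
    (hr : |r| ≤ gf * x) (ht : |t| ≤ gg * y) (hS : |S| ≤ C * ((M * x) * (M * y))) :
    |δ * (2 * (a ^ 2 * b ^ 2) + 2 * b ^ 2 * p + 2 * a ^ 2 * q) + d ^ 2
        + (a ^ 2 * y ^ 2 + x ^ 2 * (b ^ 2 + 2 * q + y ^ 2) + 4 * (p * q) + 2 * p * y ^ 2)
        - 2 * r - 2 * t - 2 * S|
      ≤ 20 * (1 + C) * M ^ 4 * (|δ| + d ^ 2 + x ^ 2 + y ^ 2 + gf ^ 2 + gg ^ 2) := by
  have hM0 : 0 ≤ M := by linarith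
  have ha2 : a ^ 2 ≤ M ^ 2 := by gcongr
  have hb2 : b ^ 2 ≤ M ^ 2 := by gcongr
  have hM2 : 1 ≤ M ^ 2 := one_le_pow₀ hM
  have hM4 : M ^ 2 ≤ M ^ 4 := pow_le_pow_right₀ hM (by norm_num)
  have hp' : |p| ≤ 2 * M ^ 2 := hp.trans (by linarith [mul_le_mul_of_nonneg_left hxM hM0])
  have hq' : |q| ≤ 2 * M ^ 2 := hq.trans (by linarith [mul_le_mul_of_nonneg_left hyM hM0])
  have hy2 : y ^ 2 ≤ 4 * M ^ 2 := by linarith [pow_le_pow_left₀ hy hyM 2]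
  have hxy : x * y ≤ (x ^ 2 + y ^ 2) / 2 := by linarith [sq_nonneg (x - y)]
  have h1 : |δ * (2 * (a ^ 2 * b ^ 2) + 2 * b ^ 2 * p + 2 * a ^ 2 * q)| ≤ 10 * M ^ 4 * |δ| := by
    have e1 : |a ^ 2 * b ^ 2| ≤ M ^ 2 * M ^ 2 := by
      rw [abs_of_nonneg (by positivity)]; gcongr
    have e2 : |b ^ 2 * p| ≤ M ^ 2 * (2 * M ^ 2) := by
      rw [abs_mul, abs_of_nonneg (sq_nonneg b)]; gcongr
    have e3 : |a ^ 2 * q| ≤ M ^ 2 * (2 * M ^ 2) := by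
      rw [abs_mul, abs_of_nonneg (sq_nonneg a)]; gcongr
    have e : |2 * (a ^ 2 * b ^ 2) + 2 * b ^ 2 * p + 2 * a ^ 2 * q| ≤ 10 * M ^ 4 := by
      rw [abs_le] at e1 e2 e3 ⊢
      constructor <;> linarith
    rw [abs_mul, mul_comm]
    gcongr
  have h2 : |a ^ 2 * y ^ 2| ≤ M ^ 2 * y ^ 2 := by
    rw [abs_of_nonneg (by positivity)]; gcongr
  have h3 : |x ^ 2 * (b ^ 2 + 2 * q + y ^ 2)| ≤ 9 * M ^ 2 * x ^ 2 := by
    have : |b ^ 2 + 2 * q + y ^ 2| ≤ 9 * M ^ 2 := by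
      rw [abs_le] at hq' ⊢
      constructor <;> linarith [sq_nonneg b, sq_nonneg y]
    rw [abs_mul, abs_of_nonneg (sq_nonneg x), mul_comm]
    gcongr
  have h4 : |p * q| ≤ M ^ 2 * ((x ^ 2 + y ^ 2) / 2) := by
    rw [abs_mul]
    calc |p| * |q| ≤ (M * x) * (M * y) := by gcongr
      _ = M ^ 2 * (x * y) := by ring
      _ ≤ _ := by gcongr
  have h5 : |p * y ^ 2| ≤ 2 * M ^ 2 * y ^ 2 := by
    rw [abs_mul, abs_of_nonneg (sq_nonneg y)]; gcongr
  have h6 : |r| ≤ (gf ^ 2 + x ^ 2) / 2 := hr.trans (by linarith [sq_nonneg (gf - x)])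
  have h7 : |t| ≤ (gg ^ 2 + y ^ 2) / 2 := ht.trans (by linarith [sq_nonneg (gg - y)])
  have h8 : |S| ≤ C * (M ^ 2 * ((x ^ 2 + y ^ 2) / 2)) := by
    refine hS.trans ?_
    calc C * ((M * x) * (M * y)) = C * (M ^ 2 * (x * y)) := by ring
      _ ≤ _ := by gcongr
  have htri : |δ * (2 * (a ^ 2 * b ^ 2) + 2 * b ^ 2 * p + 2 * a ^ 2 * q) + d ^ 2
        + (a ^ 2 * y ^ 2 + x ^ 2 * (b ^ 2 + 2 * q + y ^ 2) + 4 * (p * q) + 2 * p * y ^ 2)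
        - 2 * r - 2 * t - 2 * S|
      ≤ 10 * M ^ 4 * |δ| + d ^ 2 + M ^ 2 * y ^ 2 + 9 * M ^ 2 * x ^ 2
        + 4 * (M ^ 2 * ((x ^ 2 + y ^ 2) / 2)) + 2 * (2 * M ^ 2 * y ^ 2)
        + (gf ^ 2 + x ^ 2) + (gg ^ 2 + y ^ 2) + 2 * (C * (M ^ 2 * ((x ^ 2 + y ^ 2) / 2))) := by
    have hd : 0 ≤ d ^ 2 := sq_nonneg d
    generalize δ * (2 * (a ^ 2 * b ^ 2) + 2 * b ^ 2 * p + 2 * a ^ 2 * q) = e1 at *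
    generalize x ^ 2 * (b ^ 2 + 2 * q + y ^ 2) = e2 at *
    generalize p * q = e3 at *
    rw [mul_assoc 2 p]
    rw [abs_le] at h1 h2 h3 h4 h5 h6 h7 h8 ⊢
    constructor <;> linarith
  refine htri.trans ?_
  have c0 : 0 ≤ C * M ^ 4 := by positivity
  have k1 : C * M ^ 2 ≤ C * M ^ 4 := by gcongr
  have hδ : 10 * M ^ 4 * |δ| ≤ 20 * (1 + C) * M ^ 4 * |δ| := by gcongr; linarith
  have hK : 1 ≤ 20 * (1 + C) * M ^ 4 := by linarith
  have hd : d ^ 2 ≤ 20 * (1 + C) * M ^ 4 * d ^ 2 := le_mul_of_one_le_left (sq_nonneg d) hK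
  have hgf : gf ^ 2 ≤ 20 * (1 + C) * M ^ 4 * gf ^ 2 := le_mul_of_one_le_left (sq_nonneg gf) hK
  have hgg : gg ^ 2 ≤ 20 * (1 + C) * M ^ 4 * gg ^ 2 := le_mul_of_one_le_left (sq_nonneg gg) hK
  have hx' : (9 * M ^ 2 + 2 * M ^ 2 + 1 + C * M ^ 2) * x ^ 2 ≤ 20 * (1 + C) * M ^ 4 * x ^ 2 := by
    gcongr; linarith
  have hy' : (M ^ 2 + 2 * M ^ 2 + 4 * M ^ 2 + 1 + C * M ^ 2) * y ^ 2
      ≤ 20 * (1 + C) * M ^ 4 * y ^ 2 := by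
    gcongr; linarith
  linarith

/-- Deterministic linearization of the estimator: up to quadratic terms in centred averages, and the
defect of the average weight from `1`, it equals `2 / n * ∑ i, (1 - w i) * V i` with
`V i = ⟪f i, m⟫ ⟪g i, m'⟫ - ‖m‖² ‖m'‖²`. The terms linear in the centred averages of `f` and `g` which
come from the second sum cancel against those of the third one. -/
theorem abs_featureHSIC_sub_le {n : ℕ} (hn : n ≠ 0) {M C : ℝ} (hM : 1 ≤ M) (hC : 0 ≤ C)
    {w : Fin n → ℝ} (hw : ∀ i, |w i| ≤ C)
    {f : Fin n → F} {g : Fin n → G} {m : F} {m' : G} (hf : ∀ i, ‖f i‖ ≤ M) (hg : ∀ i, ‖g i‖ ≤ M)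
    (hm : ‖m‖ ≤ M) (hm' : ‖m'‖ ≤ M) :
    |featureHSIC w f g - 2 / n * ∑ i, (1 - w i) *
        (inner ℝ (f i) m * inner ℝ (g i) m' - ‖m‖ ^ 2 * ‖m'‖ ^ 2)|
      ≤ 20 * (1 + C) * M ^ 4 * (|1 / (n : ℝ) * ∑ i, w i - 1|
        + ‖(1 / (n : ℝ)) • ∑ i, (f i ⊗ₜ[ℝ] g i - m ⊗ₜ[ℝ] m')‖ ^ 2
        + ‖(1 / (n : ℝ)) • ∑ i, (f i - m)‖ ^ 2 + ‖(1 / (n : ℝ)) • ∑ i, (g i - m')‖ ^ 2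
        + ‖(1 / (n : ℝ)) • ∑ i, w i • ((inner ℝ (g i) m' : ℝ) • f i - ‖m'‖ ^ 2 • m)‖ ^ 2
        + ‖(1 / (n : ℝ)) • ∑ i, w i • ((inner ℝ (f i) m : ℝ) • g i - ‖m‖ ^ 2 • m')‖ ^ 2) := by
  have hn0 : (n : ℝ) ≠ 0 := Nat.cast_ne_zero.2 hn
  have hM0 : 0 ≤ M := by linarith
  set W : ℝ := 1 / (n : ℝ) * ∑ i, w i with hW
  set D := (1 / (n : ℝ)) • ∑ i, (f i ⊗ₜ[ℝ] g i - m ⊗ₜ[ℝ] m') with hD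
  set u := (1 / (n : ℝ)) • ∑ i, (f i - m) with hu
  set v := (1 / (n : ℝ)) • ∑ i, (g i - m') with hv
  set Gf := (1 / (n : ℝ)) • ∑ i, w i • ((inner ℝ (g i) m' : ℝ) • f i - ‖m'‖ ^ 2 • m) with hGf
  set Gg := (1 / (n : ℝ)) • ∑ i, w i • ((inner ℝ (f i) m : ℝ) • g i - ‖m‖ ^ 2 • m') with hGg
  -- The three parts of the estimator, expanded around the means `m` and `m'`.
  have hT1 : ‖(1 / (n : ℝ)) • ∑ i, f i ⊗ₜ[ℝ] g i‖ ^ 2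
      = ‖m‖ ^ 2 * ‖m'‖ ^ 2 + 2 * (1 / n * ∑ i, (inner ℝ (f i) m * inner ℝ (g i) m'
        - ‖m‖ ^ 2 * ‖m'‖ ^ 2)) + ‖D‖ ^ 2 := by
    rw [average_eq_add_average_sub hn _ (m ⊗ₜ[ℝ] m'), norm_add_sq_real, TensorProduct.norm_tmul, mul_pow]
    congr 3
    rw [real_inner_comm, real_inner_smul_left, sum_inner]
    simp_rw [inner_sub_left, TensorProduct.inner_tmul, real_inner_self_eq_norm_sq]
  have hT2f : ‖(1 / (n : ℝ)) • ∑ i, f i‖ ^ 2 = ‖m‖ ^ 2 + 2 * inner ℝ m u + ‖u‖ ^ 2 := by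
    rw [average_eq_add_average_sub hn f m, norm_add_sq_real]
  have hT2g : ‖(1 / (n : ℝ)) • ∑ i, g i‖ ^ 2 = ‖m'‖ ^ 2 + 2 * inner ℝ m' v + ‖v‖ ^ 2 := by
    rw [average_eq_add_average_sub hn g m', norm_add_sq_real]
  have hGfu : inner ℝ Gf u
      = 1 / n * ∑ i, w i * (inner ℝ (g i) m' * inner ℝ (f i) u - ‖m'‖ ^ 2 * inner ℝ m u) := by
    rw [hGf, real_inner_smul_left, sum_inner]
    simp_rw [real_inner_smul_left, inner_sub_left, real_inner_smul_left]
  have hGgv : inner ℝ Gg v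
      = 1 / n * ∑ i, w i * (inner ℝ (f i) m * inner ℝ (g i) v - ‖m‖ ^ 2 * inner ℝ m' v) := by
    rw [hGg, real_inner_smul_left, sum_inner]
    simp_rw [real_inner_smul_left, inner_sub_left, real_inner_smul_left]
  set S : ℝ := 1 / n * ∑ i, w i * (inner ℝ (f i) u * inner ℝ (g i) v) with hS
  set N : ℝ := 1 / n * ∑ i, w i * (inner ℝ (f i) m * inner ℝ (g i) m') with hN
  have hT3 : 2 / n * ∑ i, w i * (inner ℝ (f i) ((1 / (n : ℝ)) • ∑ j, f j) *
          inner ℝ (g i) ((1 / (n : ℝ)) • ∑ q, g q))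
      = 2 * (N + (inner ℝ Gf u + W * ‖m'‖ ^ 2 * inner ℝ m u)
        + (inner ℝ Gg v + W * ‖m‖ ^ 2 * inner ℝ m' v) + S) := by
    rw [average_eq_add_average_sub hn f m, average_eq_add_average_sub hn g m', ← hu, ← hv, hGfu, hGgv, hN, hS, hW]
    simp_rw [inner_add_right, Finset.mul_sum, Finset.sum_mul, ← Finset.sum_add_distrib,
      Finset.mul_sum]
    refine Finset.sum_congr rfl fun i _ => ?_
    ring
  have hlin : 2 / n * ∑ i, (1 - w i) * (inner ℝ (f i) m * inner ℝ (g i) m' - ‖m‖ ^ 2 * ‖m'‖ ^ 2)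
      = 2 * (1 / n * ∑ i, (inner ℝ (f i) m * inner ℝ (g i) m' - ‖m‖ ^ 2 * ‖m'‖ ^ 2))
        - 2 * N + 2 * W * (‖m‖ ^ 2 * ‖m'‖ ^ 2) := by
    rw [hN, hW]
    simp_rw [Finset.mul_sum, Finset.sum_mul, ← Finset.sum_sub_distrib, ← Finset.sum_add_distrib]
    refine Finset.sum_congr rfl fun i _ => ?_
    ring
  have hmain : featureHSIC w f g - 2 / n * ∑ i, (1 - w i) *
        (inner ℝ (f i) m * inner ℝ (g i) m' - ‖m‖ ^ 2 * ‖m'‖ ^ 2)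
      = (1 - W) * (2 * (‖m‖ ^ 2 * ‖m'‖ ^ 2) + 2 * ‖m'‖ ^ 2 * inner ℝ m u
          + 2 * ‖m‖ ^ 2 * inner ℝ m' v)
        + ‖D‖ ^ 2
        + (‖m‖ ^ 2 * ‖v‖ ^ 2 + ‖u‖ ^ 2 * (‖m'‖ ^ 2 + 2 * inner ℝ m' v + ‖v‖ ^ 2)
          + 4 * (inner ℝ m u * inner ℝ m' v) + 2 * inner ℝ m u * ‖v‖ ^ 2)
        - 2 * inner ℝ Gf u - 2 * inner ℝ Gg v - 2 * S := by
    rw [featureHSIC_eq, hlin, hT1, hT2f, hT2g, hT3]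
    ring
  have hux : ‖u‖ ≤ 2 * M := norm_average_le hn fun i =>
    (norm_sub_le _ _).trans (by linarith [hf i])
  have hvy : ‖v‖ ≤ 2 * M := norm_average_le hn fun i =>
    (norm_sub_le _ _).trans (by linarith [hg i])
  have hp : |inner ℝ m u| ≤ M * ‖u‖ :=
    (abs_real_inner_le_norm _ _).trans (by gcongr)
  have hq : |inner ℝ m' v| ≤ M * ‖v‖ :=
    (abs_real_inner_le_norm _ _).trans (by gcongr)
  have hSb : |S| ≤ C * ((M * ‖u‖) * (M * ‖v‖)) := by
    refine norm_average_le (H := ℝ) hn (h := fun i => w i * (inner ℝ (f i) u * inner ℝ (g i) v))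
      fun i => ?_
    rw [Real.norm_eq_abs, abs_mul, abs_mul]
    gcongr
    · exact hw i
    · exact (abs_real_inner_le_norm _ _).trans (by gcongr; exact hf i)
    · exact (abs_real_inner_le_norm _ _).trans (by gcongr; exact hg i)
  have hG1 := abs_real_inner_le_norm Gf u
  have hG2 := abs_real_inner_le_norm Gg v
  rw [hmain, abs_sub_comm W 1]
  exact abs_remainder_le hM hC (norm_nonneg _) (norm_nonneg _) (norm_nonneg _) (norm_nonneg _)
    hm hm' hux hvy hp hq hG1 hG2 hSb
end

/-! ### Convergence of the remainder in probability -/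

/-- Markov bound: variables dominated by variables whose means tend to `0` tend to `0` in probability. -/
theorem tendstoInMeasure_zero_of_abs_le {Ω : Type*} [MeasurableSpace Ω] {P : Measure Ω}
    {R B : ℕ → Ω → ℝ} {b : ℕ → ℝ} (hR : ∀ n, AEMeasurable (R n) P)
    (hRB : ∀ᶠ n in atTop, (∀ ω, |R n ω| ≤ B n ω) ∧ Integrable (B n) P ∧ ∫ ω, B n ω ∂P ≤ b n)
    (hb : Tendsto b atTop (𝓝 0)) : TendstoInMeasure P R atTop 0 := by
  refine tendstoInMeasure_of_tendsto_eLpNorm one_ne_zero (fun n => (hR n).aestronglyMeasurable)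
    aestronglyMeasurable_zero ?_
  have hb' : Tendsto (fun n => ENNReal.ofReal (b n)) atTop (𝓝 0) := by
    simpa using ENNReal.tendsto_ofReal hb
  refine tendsto_of_tendsto_of_tendsto_of_le_of_le' tendsto_const_nhds hb'
    (Eventually.of_forall fun _ => zero_le) ?_
  filter_upwards [hRB] with n ⟨h1, h2, h3⟩
  rw [sub_zero, eLpNorm_one_eq_lintegral_enorm]
  calc ∫⁻ ω, ‖R n ω‖ₑ ∂P ≤ ∫⁻ ω, ENNReal.ofReal (B n ω) ∂P := by
        refine lintegral_mono fun ω => ?_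
        rw [Real.enorm_eq_ofReal_abs]
        exact ENNReal.ofReal_le_ofReal (h1 ω)
    _ = ENNReal.ofReal (∫ ω, B n ω ∂P) :=
        (ofReal_integral_eq_lintegral_ofReal h2
          (Eventually.of_forall fun ω => (abs_nonneg _).trans (h1 ω))).symm
    _ ≤ ENNReal.ofReal (b n) := ENNReal.ofReal_le_ofReal h3

theorem integrable_add_and_integral_add_le {Ω : Type*} [MeasurableSpace Ω] {P : Measure Ω}
    {u v : Ω → ℝ} {a b : ℝ} (hu : Integrable u P ∧ ∫ ω, u ω ∂P ≤ a)
    (hv : Integrable v P ∧ ∫ ω, v ω ∂P ≤ b) :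
    Integrable (fun ω => u ω + v ω) P ∧ ∫ ω, u ω + v ω ∂P ≤ a + b :=
  ⟨hu.1.add hv.1, (integral_add hu.1 hv.1).trans_le (add_le_add hu.2 hv.2)⟩

/-! ### Centring under a product law -/

theorem integrable_inner_mul_inner_prod {F G 𝒳 𝒴 : Type*} [NormedAddCommGroup F]
    [InnerProductSpace ℝ F] [NormedAddCommGroup G] [InnerProductSpace ℝ G] [MeasurableSpace 𝒳]
    [MeasurableSpace 𝒴] {α : Measure 𝒳} {β : Measure 𝒴} {f : 𝒳 → F} {g : 𝒴 → G}
    (hf : Integrable f α) (hg : Integrable g β) (h : F) (k : G) :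
    Integrable (fun z : 𝒳 × 𝒴 => (inner ℝ h (f z.1) : ℝ) * inner ℝ k (g z.2)) (α.prod β) :=
  Integrable.mul_prod (hf.const_inner h) (hg.const_inner k)

section
variable {F G : Type*} [NormedAddCommGroup F] [InnerProductSpace ℝ F] [CompleteSpace F]
  [NormedAddCommGroup G] [InnerProductSpace ℝ G] [CompleteSpace G]
  {𝒳 𝒴 : Type*} [MeasurableSpace 𝒳] [MeasurableSpace 𝒴]
  {α : Measure 𝒳} {β : Measure 𝒴} [IsProbabilityMeasure α] [IsProbabilityMeasure β]
  {f : 𝒳 → F} {g : 𝒴 → G}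

theorem integral_inner_mul_inner_prod (hf : Integrable f α) (hg : Integrable g β) (h : F) (k : G) :
    ∫ z, (inner ℝ h (f z.1) : ℝ) * inner ℝ k (g z.2) ∂α.prod β
      = inner ℝ h (∫ x, f x ∂α) * inner ℝ k (∫ y, g y ∂β) := by
  rw [integral_prod_mul (fun x => (inner ℝ h (f x) : ℝ)) (fun y => inner ℝ k (g y)),
    integral_inner hf, integral_inner hg]

theorem integral_inner_fst_sub (hf : Integrable f α) (h : F) :
    ∫ z : 𝒳 × 𝒴, (inner ℝ h (f z.1 - ∫ x, f x ∂α) : ℝ) ∂α.prod β = 0 := by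
  rw [integral_inner (f := fun z : 𝒳 × 𝒴 => f z.1 - ∫ x, f x ∂α)
    ((hf.comp_fst β).sub (integrable_const _)), integral_sub (hf.comp_fst β) (integrable_const _), integral_fun_fst]
  simp

theorem integral_inner_snd_sub (hg : Integrable g β) (k : G) :
    ∫ z : 𝒳 × 𝒴, (inner ℝ k (g z.2 - ∫ y, g y ∂β) : ℝ) ∂α.prod β = 0 := by
  rw [integral_inner (f := fun z : 𝒳 × 𝒴 => g z.2 - ∫ y, g y ∂β)
    ((hg.comp_snd α).sub (integrable_const _)), integral_sub (hg.comp_snd α) (integrable_const _), integral_fun_snd]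
  simp

theorem integral_inner_smul_fst_sub (hf : Integrable f α) (hg : Integrable g β) (h : F) :
    ∫ z : 𝒳 × 𝒴, (inner ℝ h ((inner ℝ (g z.2) (∫ y, g y ∂β) : ℝ) • f z.1
      - ‖∫ y, g y ∂β‖ ^ 2 • ∫ x, f x ∂α) : ℝ) ∂α.prod β = 0 := by
  have h1 : ∀ z : 𝒳 × 𝒴, (inner ℝ h ((inner ℝ (g z.2) (∫ y, g y ∂β) : ℝ) • f z.1
      - ‖∫ y, g y ∂β‖ ^ 2 • ∫ x, f x ∂α) : ℝ)
      = inner ℝ h (f z.1) * inner ℝ (∫ y, g y ∂β) (g z.2)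
        - ‖∫ y, g y ∂β‖ ^ 2 * inner ℝ h (∫ x, f x ∂α) := fun z => by
    rw [inner_sub_right, real_inner_smul_right, real_inner_smul_right, mul_comm,
      real_inner_comm (g z.2)]
  simp_rw [h1]
  rw [integral_sub (integrable_inner_mul_inner_prod hf hg _ _) (integrable_const _),
    integral_inner_mul_inner_prod hf hg, real_inner_self_eq_norm_sq]
  simp
  ring

theorem integral_inner_smul_snd_sub (hf : Integrable f α) (hg : Integrable g β) (k : G) :
    ∫ z : 𝒳 × 𝒴, (inner ℝ k ((inner ℝ (f z.1) (∫ x, f x ∂α) : ℝ) • g z.2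
      - ‖∫ x, f x ∂α‖ ^ 2 • ∫ y, g y ∂β) : ℝ) ∂α.prod β = 0 := by
  have h1 : ∀ z : 𝒳 × 𝒴, (inner ℝ k ((inner ℝ (f z.1) (∫ x, f x ∂α) : ℝ) • g z.2
      - ‖∫ x, f x ∂α‖ ^ 2 • ∫ y, g y ∂β) : ℝ)
      = inner ℝ (∫ x, f x ∂α) (f z.1) * inner ℝ k (g z.2)
        - ‖∫ x, f x ∂α‖ ^ 2 * inner ℝ k (∫ y, g y ∂β) := fun z => by
    rw [inner_sub_right, real_inner_smul_right, real_inner_smul_right,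
      real_inner_comm (f z.1)]
  simp_rw [h1]
  rw [integral_sub (integrable_inner_mul_inner_prod hf hg _ _) (integrable_const _),
    integral_inner_mul_inner_prod hf hg, real_inner_self_eq_norm_sq]
  simp

theorem integral_inner_tmul_sub (hf : Integrable f α) (hg : Integrable g β) (z₀ : 𝒳 × 𝒴) :
    ∫ z : 𝒳 × 𝒴, (inner ℝ (f z₀.1 ⊗ₜ[ℝ] g z₀.2 - (∫ x, f x ∂α) ⊗ₜ[ℝ] (∫ y, g y ∂β))
      (f z.1 ⊗ₜ[ℝ] g z.2 - (∫ x, f x ∂α) ⊗ₜ[ℝ] (∫ y, g y ∂β)) : ℝ) ∂α.prod β = 0 := by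
  simp_rw [inner_sub_left, inner_sub_right, TensorProduct.inner_tmul]
  have hi := integrable_inner_mul_inner_prod hf hg
  have hi' : ∀ (h : F) (k : G) (c : ℝ), Integrable (fun z : 𝒳 × 𝒴 =>
      (inner ℝ h (f z.1) : ℝ) * inner ℝ k (g z.2) - c) (α.prod β) :=
    fun h k c => (hi h k).sub (integrable_const c)
  rw [integral_sub (hi' _ _ _) (hi' _ _ _),
    integral_sub (hi _ _) (integrable_const _), integral_sub (hi _ _) (integrable_const _),
    integral_inner_mul_inner_prod hf hg, integral_inner_mul_inner_prod hf hg]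
  simp

/-! ### The limit law for general feature maps -/

/-- Asymptotic normality of the weighted estimator under independence, for arbitrary bounded strongly
measurable feature maps into Hilbert spaces. It follows from the weighted central limit theorem for
the linear part, with weights `2 (1 - w i)`, and from a remainder of mean `O(1 / √n)`. -/
theorem tendstoInDistribution_featureHSIC {Ω : Type*} [MeasurableSpace Ω] {P : Measure Ω}
    [IsProbabilityMeasure P] {Z : ℕ → Ω → 𝒳 × 𝒴} (hZ : ∀ i, Measurable (Z i))
    (hindep : iIndepFun Z P) (hlaw : ∀ i, P.map (Z i) = α.prod β)
    (hf : StronglyMeasurable f) (hg : StronglyMeasurable g) {M : ℝ} (hM : 1 ≤ M)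
    (hfM : ∀ x, ‖f x‖ ≤ M) (hgM : ∀ y, ‖g y‖ ≤ M)
    {m : F} (hm : m = ∫ x, f x ∂α) {m' : G} (hm' : m' = ∫ y, g y ∂β)
    {w : (n : ℕ) → Fin n → ℝ} {C : ℝ} (hC : 1 ≤ C) (hw : ∀ n i, |w n i| ≤ C) {τ : ℝ}
    (hτ : ∀ᶠ n : ℕ in atTop, (n : ℝ) * |1 / (n : ℝ) * (∑ i, w n i) - 1| ≤ τ) {s : ℝ} (hs : 1 ≤ s)
    (hlim : Tendsto (fun n : ℕ => 1 / (n : ℝ) * ∑ i, w n i ^ 2) atTop (𝓝 s)) :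
    TendstoInDistribution (fun (n : ℕ) ω => √(n : ℝ) *
        featureHSIC (w n) (fun i => f (Z i ω).1) (fun i => g (Z i ω).2)) atTop (id : ℝ → ℝ)
      (fun _ => P) (gaussianReal 0 (Real.toNNReal (4 * (s - 1) * variance (fun ω =>
        (inner ℝ (f (Z 0 ω).1) m * inner ℝ (g (Z 0 ω).2) m' - ‖m‖ ^ 2 * ‖m'‖ ^ 2 : ℝ)) P))) := by
  have hM0 : 0 ≤ M := by linarith
  have hC0 : 0 ≤ C := by linarith
  have hfi : Integrable f α := .of_bound hf.aestronglyMeasurable M (Eventually.of_forall hfM)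
  have hgi : Integrable g β := .of_bound hg.aestronglyMeasurable M (Eventually.of_forall hgM)
  have hmM : ‖m‖ ≤ M := by
    rw [hm]
    simpa using norm_integral_le_of_norm_le_const (μ := α) (Eventually.of_forall hfM)
  have hmM' : ‖m'‖ ≤ M := by
    rw [hm']
    simpa using norm_integral_le_of_norm_le_const (μ := β) (Eventually.of_forall hgM)
  -- The linear part of the estimator is a weighted sum of the `V (Z i ω)`.
  set V : 𝒳 × 𝒴 → ℝ := fun z => inner ℝ (f z.1) m * inner ℝ (g z.2) m' - ‖m‖ ^ 2 * ‖m'‖ ^ 2 with hV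
  have hfm : Measurable fun z : 𝒳 × 𝒴 => (inner ℝ (f z.1) m : ℝ) :=
    ((hf.comp_measurable measurable_fst).inner stronglyMeasurable_const).measurable
  have hgm : Measurable fun z : 𝒳 × 𝒴 => (inner ℝ (g z.2) m' : ℝ) :=
    ((hg.comp_measurable measurable_snd).inner stronglyMeasurable_const).measurable
  have hVm : Measurable V := (hfm.mul hgm).sub_const _
  have hVb : ∀ z, ‖V z‖ ≤ M * M * (M * M) + ‖‖m‖ ^ 2 * ‖m'‖ ^ 2‖ := fun z => by
    refine (norm_sub_le _ _).trans ?_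
    rw [norm_mul]
    gcongr
    · exact (norm_inner_le_norm _ _).trans (by gcongr; exact hfM _)
    · exact (norm_inner_le_norm _ _).trans (by gcongr; exact hgM _)
  have hV0 : ∫ ω, V (Z 0 ω) ∂P = 0 := by
    rw [← integral_map (f := V) (hZ 0).aemeasurable hVm.aestronglyMeasurable, hlaw, hV]
    simp_rw [real_inner_comm _ (f _), real_inner_comm _ (g _)]
    rw [integral_sub (integrable_inner_mul_inner_prod hfi hgi m m') (integrable_const _),
      integral_inner_mul_inner_prod hfi hgi, ← hm, ← hm', real_inner_self_eq_norm_sq,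
      real_inner_self_eq_norm_sq]
    simp
  have hclt := tendstoInDistribution_weighted_sum (P := P) (ξ := fun i ω => V (Z i ω))
    (hindep.comp (fun _ => V) fun _ => hVm)
    (fun i => IdentDistrib.comp (f := Z i) (g := Z 0)
      ⟨(hZ i).aemeasurable, (hZ 0).aemeasurable, by rw [hlaw, hlaw]⟩ hVm)
    (MemLp.of_bound (hVm.comp (hZ 0)).aestronglyMeasurable _
      (Eventually.of_forall fun ω => hVb _)) hV0
    (c := fun n i => 2 * (1 - w n i)) (C := 2 * (1 + C)) (fun n i => by
      rw [abs_mul, abs_two]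
      gcongr
      refine (abs_sub _ _).trans ?_
      rw [abs_one]
      gcongr
      exact hw n i)
    -- `(1 - w)² = w² - 2 w + 1`, and the averages of `w²` and `w` tend to `s` and `1`.
    (s := 4 * (s - 1)) (by linarith) (by
      have hmean : Tendsto (fun n : ℕ => 1 / (n : ℝ) * (∑ i, w n i)) atTop (𝓝 1) := by
        rw [tendsto_iff_norm_sub_tendsto_zero]
        refine tendsto_of_tendsto_of_tendsto_of_le_of_le' tendsto_const_nhds
          (tendsto_const_nhds (x := τ).div_atTop tendsto_natCast_atTop_atTop)
          (Eventually.of_forall fun _ => norm_nonneg _) ?_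
        filter_upwards [hτ, eventually_gt_atTop 0] with n hn hn0
        rw [Real.norm_eq_abs, le_div_iff₀ (Nat.cast_pos.2 hn0), mul_comm]
        exact hn
      have h := ((hlim.sub (hmean.const_mul 2)).add_const 1).const_mul 4
      refine (h.congr' ?_).trans_eq (by congr 1; ring)
      filter_upwards [eventually_gt_atTop 0] with n hn0
      have hn0' : (n : ℝ) ≠ 0 := Nat.cast_ne_zero.2 hn0.ne'
      have hone : (1 : ℝ) = 1 / (n : ℝ) * ∑ _i : Fin n, (1 : ℝ) := by simp [hn0']
      calc _ = 4 * (1 / (n : ℝ) * ∑ i, w n i ^ 2 - 2 * (1 / (n : ℝ) * ∑ i, w n i)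
            + 1 / (n : ℝ) * ∑ _i : Fin n, (1 : ℝ)) := by rw [← hone]
        _ = _ := by
          simp_rw [Finset.mul_sum, ← Finset.sum_sub_distrib, ← Finset.sum_add_distrib,
            Finset.mul_sum]
          refine Finset.sum_congr rfl fun i _ => ?_
          ring)
  have hmeas : ∀ n : ℕ, Measurable fun ω => √(n : ℝ) *
      featureHSIC (w n) (fun i => f (Z i ω).1) (fun i => g (Z i ω).2) := by
    intro n
    have hff : ∀ i j : ℕ, Measurable fun ω => (inner ℝ (f (Z i ω).1) (f (Z j ω).1) : ℝ) :=
      fun i j => ((hf.comp_measurable (hZ i).fst).inner (hf.comp_measurable (hZ j).fst)).measurable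
    have hgg : ∀ i j : ℕ, Measurable fun ω => (inner ℝ (g (Z i ω).2) (g (Z j ω).2) : ℝ) :=
      fun i j => ((hg.comp_measurable (hZ i).snd).inner (hg.comp_measurable (hZ j).snd)).measurable
    unfold featureHSIC
    fun_prop
  refine tendstoInDistribution_of_tendstoInMeasure_sub _ _ hclt ?_ fun n => (hmeas n).aemeasurable
  set K := 20 * (1 + C) * M ^ 4 with hK
  have hK0 : 0 ≤ K := by positivity
  set R := C ^ 2 * (2 * M ^ 3) ^ 2 with hR
  have hMM : M ≤ M ^ 3 := le_self_pow₀ hM (by norm_num)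
  have hMM2 : M ^ 2 ≤ M ^ 3 := pow_le_pow_right₀ hM (by norm_num)
  have hone : ∀ {n : ℕ} (_i : Fin n), |(1 : ℝ)| ≤ C := fun _ => by simpa using hC
  -- `2 * M ^ 3` is a common bound of the five centred vectors, since `1 ≤ M`.
  have hu : ∀ n : ℕ, _ := fun n => integral_norm_sq_weighted_average_le (P := P)
    (ρ := α.prod β) hZ hindep hlaw (F := fun z => f z.1 - m) (M := 2 * M ^ 3) (by
      have h1 : StronglyMeasurable fun z : 𝒳 × 𝒴 => f z.1 - m :=
        (hf.comp_measurable measurable_fst).sub stronglyMeasurable_const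
      exact ((h1.comp_measurable measurable_fst).inner
        (h1.comp_measurable measurable_snd)).measurable)
    (fun z => (norm_sub_le _ _).trans (by linarith [hfM z.1]))
    (fun z => by rw [hm]; exact integral_inner_fst_sub hfi _) (n := n) (c := fun _ => 1) hone
  have hv : ∀ n : ℕ, _ := fun n => integral_norm_sq_weighted_average_le (P := P)
    (ρ := α.prod β) hZ hindep hlaw (F := fun z => g z.2 - m') (M := 2 * M ^ 3) (by
      have h1 : StronglyMeasurable fun z : 𝒳 × 𝒴 => g z.2 - m' :=
        (hg.comp_measurable measurable_snd).sub stronglyMeasurable_const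
      exact ((h1.comp_measurable measurable_fst).inner
        (h1.comp_measurable measurable_snd)).measurable)
    (fun z => (norm_sub_le _ _).trans (by linarith [hgM z.2]))
    (fun z => by rw [hm']; exact integral_inner_snd_sub hgi _) (n := n) (c := fun _ => 1) hone
  have hGf : ∀ n : ℕ, _ := fun n => integral_norm_sq_weighted_average_le (P := P)
    (ρ := α.prod β) hZ hindep hlaw
    (F := fun z => (inner ℝ (g z.2) m' : ℝ) • f z.1 - ‖m'‖ ^ 2 • m) (M := 2 * M ^ 3) (by
      have h1 : StronglyMeasurable fun z : 𝒳 × 𝒴 =>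
          (inner ℝ (g z.2) m' : ℝ) • f z.1 - ‖m'‖ ^ 2 • m :=
        (hgm.stronglyMeasurable.smul (hf.comp_measurable measurable_fst)).sub
          stronglyMeasurable_const
      exact ((h1.comp_measurable measurable_fst).inner
        (h1.comp_measurable measurable_snd)).measurable)
    (fun z => by
      have h1 : ‖(inner ℝ (g z.2) m' : ℝ) • f z.1‖ ≤ M * M * M := by
        rw [norm_smul]
        gcongr
        · exact (norm_inner_le_norm _ _).trans (by gcongr; exact hgM _)
        · exact hfM _
      have h2 : ‖‖m'‖ ^ 2 • m‖ ≤ M ^ 2 * M := by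
        rw [norm_smul, Real.norm_of_nonneg (by positivity)]
        gcongr
      exact (norm_sub_le _ _).trans (by linarith))
    (fun z => by rw [hm, hm']; exact integral_inner_smul_fst_sub hfi hgi _) (n := n) (hw n)
  have hGg : ∀ n : ℕ, _ := fun n => integral_norm_sq_weighted_average_le (P := P)
    (ρ := α.prod β) hZ hindep hlaw
    (F := fun z => (inner ℝ (f z.1) m : ℝ) • g z.2 - ‖m‖ ^ 2 • m') (M := 2 * M ^ 3) (by
      have h1 : StronglyMeasurable fun z : 𝒳 × 𝒴 =>
          (inner ℝ (f z.1) m : ℝ) • g z.2 - ‖m‖ ^ 2 • m' :=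
        (hfm.stronglyMeasurable.smul (hg.comp_measurable measurable_snd)).sub
          stronglyMeasurable_const
      exact ((h1.comp_measurable measurable_fst).inner
        (h1.comp_measurable measurable_snd)).measurable)
    (fun z => by
      have h1 : ‖(inner ℝ (f z.1) m : ℝ) • g z.2‖ ≤ M * M * M := by
        rw [norm_smul]
        gcongr
        · exact (norm_inner_le_norm _ _).trans (by gcongr; exact hfM _)
        · exact hgM _
      have h2 : ‖‖m‖ ^ 2 • m'‖ ≤ M ^ 2 * M := by
        rw [norm_smul, Real.norm_of_nonneg (by positivity)]
        gcongr
      exact (norm_sub_le _ _).trans (by linarith))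
    (fun z => by rw [hm, hm']; exact integral_inner_smul_snd_sub hfi hgi _) (n := n) (hw n)
  have hD : ∀ n : ℕ, _ := fun n => integral_norm_sq_weighted_average_le (P := P)
    (ρ := α.prod β) hZ hindep hlaw
    (F := fun z => f z.1 ⊗ₜ[ℝ] g z.2 - m ⊗ₜ[ℝ] m') (M := 2 * M ^ 3) (by
      simp_rw [inner_sub_left, inner_sub_right, TensorProduct.inner_tmul]
      have hff : Measurable fun p : (𝒳 × 𝒴) × (𝒳 × 𝒴) => (inner ℝ (f p.1.1) (f p.2.1) : ℝ) :=
        ((hf.comp_measurable measurable_fst.fst).inner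
          (hf.comp_measurable measurable_snd.fst)).measurable
      have hgg : Measurable fun p : (𝒳 × 𝒴) × (𝒳 × 𝒴) => (inner ℝ (g p.1.2) (g p.2.2) : ℝ) :=
        ((hg.comp_measurable measurable_fst.snd).inner
          (hg.comp_measurable measurable_snd.snd)).measurable
      have h1 : Measurable fun z : 𝒳 × 𝒴 => (inner ℝ m (f z.1) : ℝ) := by
        simpa only [real_inner_comm] using hfm
      have h2 : Measurable fun z : 𝒳 × 𝒴 => (inner ℝ m' (g z.2) : ℝ) := by
        simpa only [real_inner_comm] using hgm
      exact ((hff.mul hgg).sub ((hfm.comp measurable_fst).mul (hgm.comp measurable_fst))).sub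
        (((h1.comp measurable_snd).mul (h2.comp measurable_snd)).sub_const _))
    (fun z => by
      have h1 : ‖f z.1‖ * ‖g z.2‖ ≤ M * M :=
        mul_le_mul (hfM _) (hgM _) (norm_nonneg _) hM0
      have h2 : ‖m‖ * ‖m'‖ ≤ M * M := mul_le_mul hmM hmM' (norm_nonneg _) hM0
      refine (norm_sub_le _ _).trans ?_
      rw [TensorProduct.norm_tmul, TensorProduct.norm_tmul]
      linarith)
    (fun z => by rw [hm, hm']; exact integral_inner_tmul_sub hfi hgi _) (n := n) (c := fun _ => 1)
    hone
  simp only [one_smul] at hu hv hD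
  set B : ℕ → Ω → ℝ := fun n ω => √(n : ℝ) * (K * (|1 / (n : ℝ) * ∑ i, w n i - 1|
        + ‖(1 / (n : ℝ)) • ∑ i : Fin n, (f (Z i ω).1 ⊗ₜ[ℝ] g (Z i ω).2 - m ⊗ₜ[ℝ] m')‖ ^ 2
        + ‖(1 / (n : ℝ)) • ∑ i : Fin n, (f (Z i ω).1 - m)‖ ^ 2
        + ‖(1 / (n : ℝ)) • ∑ i : Fin n, (g (Z i ω).2 - m')‖ ^ 2
        + ‖(1 / (n : ℝ)) • ∑ i : Fin n, w n i •
            ((inner ℝ (g (Z i ω).2) m' : ℝ) • f (Z i ω).1 - ‖m'‖ ^ 2 • m)‖ ^ 2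
        + ‖(1 / (n : ℝ)) • ∑ i : Fin n, w n i •
            ((inner ℝ (f (Z i ω).1) m : ℝ) • g (Z i ω).2 - ‖m‖ ^ 2 • m')‖ ^ 2)) with hB
  refine tendstoInMeasure_zero_of_abs_le (B := B) (b := fun n => K * (τ + 5 * R) / √(n : ℝ))
    (fun n => (hmeas n).aemeasurable.sub (hclt.forall_aemeasurable n)) ?_
    (tendsto_const_nhds.div_atTop (Real.tendsto_sqrt_atTop.comp tendsto_natCast_atTop_atTop))
  filter_upwards [hτ, eventually_gt_atTop 0] with n hn hn0
  have hn0' : (0 : ℝ) < n := Nat.cast_pos.2 hn0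
  have hsq : √(n : ℝ) * √(n : ℝ) = n := Real.mul_self_sqrt hn0'.le
  have hsq0 : 0 < √(n : ℝ) := Real.sqrt_pos.2 hn0'
  have hconst : Integrable (fun _ : Ω => |1 / (n : ℝ) * ∑ i, w n i - 1|) P ∧
      ∫ _, |1 / (n : ℝ) * ∑ i, w n i - 1| ∂P ≤ τ / n := by
    refine ⟨integrable_const _, ?_⟩
    rw [integral_const, probReal_univ, one_smul, le_div_iff₀ hn0', mul_comm]
    exact hn
  obtain ⟨hBi, hBle⟩ := integrable_add_and_integral_add_le (integrable_add_and_integral_add_le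
    (integrable_add_and_integral_add_le (integrable_add_and_integral_add_le
      (integrable_add_and_integral_add_le hconst (hD n)) (hu n)) (hv n)) (hGf n)) (hGg n)
  refine ⟨fun ω => ?_, (hBi.const_mul _).const_mul _, ?_⟩
  · have hlin : ∑ i : Fin n, 2 * (1 - w n i) / √(n : ℝ) * V (Z i ω)
        = √(n : ℝ) * (2 / n * ∑ i : Fin n, (1 - w n i) * V (Z i ω)) := by
      rw [Finset.mul_sum, Finset.mul_sum]
      refine Finset.sum_congr rfl fun i _ => ?_
      linear_combination (-2 * (1 - w n i) * V (Z i ω)) * Real.sqrt_div_self' (x := (n : ℝ))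
    have key := abs_featureHSIC_sub_le hn0.ne' hM hC0 (hw n) (f := fun i : Fin n => f (Z i ω).1)
      (g := fun i : Fin n => g (Z i ω).2) (m := m) (m' := m') (fun i => hfM _) (fun i => hgM _)
      hmM hmM'
    simp only [Pi.sub_apply]
    rw [hlin, ← mul_sub, abs_mul, abs_of_nonneg hsq0.le]
    exact mul_le_mul_of_nonneg_left key hsq0.le
  · have hint : ∫ ω, B n ω ∂P ≤ √(n : ℝ) * (K * (τ / n + R / n + R / n + R / n + R / n + R / n)) := by
      rw [hB]
      simp only
      rw [integral_const_mul, integral_const_mul]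
      exact mul_le_mul_of_nonneg_left (mul_le_mul_of_nonneg_left hBle hK0) hsq0.le
    refine hint.trans (le_of_eq ?_)
    rw [eq_div_iff hsq0.ne']
    field_simp
    rw [Real.sq_sqrt hn0'.le]
    ring
end

/-! ### Features of a reproducing kernel Hilbert space -/

section
variable {𝒳 : Type*} (H : Type*) [NormedAddCommGroup H] [InnerProductSpace ℝ H] [CompleteSpace H]
  [RKHS ℝ H 𝒳 ℝ]

theorem inner_feature_feature (x y : 𝒳) :
    (inner ℝ (feature H x) (feature H y) : ℝ) = kern H x y := by
  rw [feature, feature, kern, RKHS.kerFun_inner, RKHS.kerFun_apply]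
  simp

theorem modHSIC_eq_featureHSIC {𝒴 : Type*} (H' : Type*) [NormedAddCommGroup H']
    [InnerProductSpace ℝ H'] [CompleteSpace H'] [RKHS ℝ H' 𝒴 ℝ] {n : ℕ} (w : Fin n → ℝ)
    (x : Fin n → 𝒳) (y : Fin n → 𝒴) :
    modHSIC H H' w x y = featureHSIC w (fun i => feature H (x i)) (fun i => feature H' (y i)) := by
  simp_rw [modHSIC, featureHSIC, inner_feature_feature]

theorem exists_norm_feature_le (hb : KernelBounded H) :
    ∃ M : ℝ, 1 ≤ M ∧ ∀ x : 𝒳, ‖feature H x‖ ≤ M := by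
  obtain ⟨c, hc⟩ := hb
  refine ⟨max 1 c, le_max_left _ _, fun x => ?_⟩
  have h1 : ‖feature H x‖ ^ 2 ≤ c := by
    rw [← real_inner_self_eq_norm_sq, inner_feature_feature]
    exact hc ⟨(x, x), rfl⟩
  have h2 : (1 : ℝ) ≤ max 1 c := le_max_left _ _
  refine le_of_sq_le_sq ?_ (by linarith)
  calc ‖feature H x‖ ^ 2 ≤ max 1 c := h1.trans (le_max_right _ _)
    _ ≤ max 1 c ^ 2 := le_self_pow₀ h2 (by norm_num)

theorem continuous_feature [TopologicalSpace 𝒳]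
    (hc : Continuous fun p : 𝒳 × 𝒳 => kern H p.1 p.2) : Continuous (feature H : 𝒳 → H) := by
  rw [continuous_iff_continuousAt]
  intro x
  rw [ContinuousAt, tendsto_iff_norm_sub_tendsto_zero]
  have h : ∀ y, ‖feature H y - feature H x‖
      = √(kern H y y - 2 * kern H y x + kern H x x) := fun y => by
    rw [← inner_feature_feature, ← inner_feature_feature, ← inner_feature_feature,
      real_inner_self_eq_norm_sq, real_inner_self_eq_norm_sq, ← norm_sub_sq_real,
      Real.sqrt_sq (norm_nonneg _)]
  have h1 : Continuous fun y => kern H y y := hc.comp (f := fun y => (y, y)) (by fun_prop)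
  have h2 : Continuous fun y => kern H y x := hc.comp (f := fun y => (y, x)) (by fun_prop)
  have h3 : Continuous fun y => ‖feature H y - feature H x‖ := by
    simp_rw [h]
    exact ((h1.sub (h2.const_mul 2)).add continuous_const).sqrt
  simpa using h3.tendsto x
end

/-! ### Hilbert–Schmidt inner products of rank-one operators -/

section
variable {F G : Type*} [NormedAddCommGroup F] [InnerProductSpace ℝ F]
  [NormedAddCommGroup G] [InnerProductSpace ℝ G] [CompleteSpace G]

theorem hasSum_inner_tensorOp (g k : G) (f h : F) :
    HasSum (fun i => (inner ℝ (tensorOp g f (hilbBasis G i)) (tensorOp k h (hilbBasis G i)) : ℝ))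
      (inner ℝ f h * inner ℝ g k) := by
  have h1 : ∀ i, (inner ℝ (tensorOp g f (hilbBasis G i)) (tensorOp k h (hilbBasis G i)) : ℝ)
      = inner ℝ f h * (inner ℝ g (hilbBasis G i) * inner ℝ (hilbBasis G i) k) := fun i => by
    rw [tensorOp, tensorOp, InnerProductSpace.rankOne_apply, InnerProductSpace.rankOne_apply,
      real_inner_smul_left, real_inner_smul_right, real_inner_comm k]
    ring
  rw [funext h1]
  exact ((hilbBasis G).hasSum_inner_mul_inner g k).mul_left (inner ℝ f h)

theorem hsInner_tensorOp_sub (g k l : G) (f h p : F) :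
    hsInner (tensorOp g f - tensorOp k h) (tensorOp l p)
      = inner ℝ f p * inner ℝ g l - inner ℝ h p * inner ℝ k l := by
  rw [hsInner, ← ((hasSum_inner_tensorOp g l f p).sub (hasSum_inner_tensorOp k l h p)).tsum_eq]
  refine tsum_congr fun i => ?_
  rw [_root_.sub_apply, inner_sub_left]

end
section
variable {F G : Type*} [NormedAddCommGroup F] [InnerProductSpace ℝ F] [CompleteSpace F]
  [NormedAddCommGroup G] [InnerProductSpace ℝ G] [CompleteSpace G]
  {𝒳 𝒴 : Type*} [MeasurableSpace 𝒳] [MeasurableSpace 𝒴]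
  {α : Measure 𝒳} {β : Measure 𝒴} [IsProbabilityMeasure α] [IsProbabilityMeasure β]
  {f : 𝒳 → F} {g : 𝒴 → G}

/-- Under a product law the mean of `g ⊗ f` is the tensor product of the means. -/
theorem integral_tensorOp_prod (hf : Integrable f α) (hg : Integrable g β) :
    ∫ z, tensorOp (g z.2) (f z.1) ∂α.prod β = tensorOp (∫ y, g y ∂β) (∫ x, f x ∂α) :=
  integral_prod_bilin (InnerProductSpace.rankOne ℝ : F →L[ℝ] G →L[ℝ] G →L[ℝ] F) hf hg
end

end

end HSIC

theorem corollary1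
    {𝒳 : Type*} [MetricSpace 𝒳] [CompactSpace 𝒳] [MeasurableSpace 𝒳] [BorelSpace 𝒳]
    {𝒴 : Type*} [MetricSpace 𝒴] [CompactSpace 𝒴] [MeasurableSpace 𝒴] [BorelSpace 𝒴]
    {HX : Type*} [NormedAddCommGroup HX] [InnerProductSpace ℝ HX] [CompleteSpace HX]
    [RKHS ℝ HX 𝒳 ℝ]
    {HY : Type*} [NormedAddCommGroup HY] [InnerProductSpace ℝ HY] [CompleteSpace HY]
    [RKHS ℝ HY 𝒴 ℝ]
    {Ω : Type*} [MeasurableSpace Ω] (P : Measure Ω) [IsProbabilityMeasure P]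
    -- the pair of random variables under study
    (X : Ω → 𝒳) (Y : Ω → 𝒴) (hX : Measurable X) (hY : Measurable Y)
    -- the i.i.d. sample: `(Xs i, Ys i)`, `i = 0, 1, …`, are copies of `(X, Y)`
    (Xs : ℕ → Ω → 𝒳) (Ys : ℕ → Ω → 𝒴)
    (hXs : ∀ i, Measurable (Xs i)) (hYs : ∀ i, Measurable (Ys i))
    (hindep : iIndepFun (fun i ω => (Xs i ω, Ys i ω)) P)
    (hident : ∀ i, IdentDistrib (fun ω => (Xs i ω, Ys i ω)) (fun ω => (X ω, Y ω)) P P)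
    -- bounded kernels
    (hA1X : KernelBounded HX) (hA1Y : KernelBounded HY)
    -- universality (the spaces are compact)
    (hA2X : Universal HX) (hA2Y : Universal HY)
    -- the weights `w γ r i`, `i < r`
    (w : ℝ → (r : ℕ) → Fin r → ℝ)
    (hw : ∀ γ ∈ Set.Ioc (0 : ℝ) 1, ∀ r, ∀ i, 0 ≤ w γ r i)
    (hA3 : ∀ γ ∈ Set.Ioc (0 : ℝ) 1, ∃ τ : ℝ, 0 < τ ∧ ∃ n₀ : ℕ, ∀ r : ℕ, n₀ < r →
      (r : ℝ) * |1 / (r : ℝ) * (∑ i, w γ r i) - 1| ≤ τ)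
    (hA4 : ∃ C : ℝ, 0 < C ∧ ∀ γ ∈ Set.Ioc (0 : ℝ) 1, ∀ r, ∀ i, w γ r i < C)
    (wlim : ℝ → ℝ)
    (hA5 : ∀ γ ∈ Set.Ioc (0 : ℝ) 1,
      Tendsto (fun r : ℕ => 1 / (r : ℝ) * ∑ i, w γ r i ^ 2) atTop (𝓝 (wlim γ ^ 2)) ∧
        1 < wlim γ ^ 2)
    -- the null hypothesis: the joint law is the product of the marginal laws
    (hH0 : P.map (fun ω => (X ω, Y ω)) = (P.map X).prod (P.map Y)) :
    hsic HX HY P X Y = 0 ∧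
    muOp HX HY P X Y = nuOp HX HY P X Y ∧
    (∀ x y, funU HX HY P X Y x y = funV HX HY P X Y x y) ∧
    ∀ γ ∈ Set.Ioc (0 : ℝ) 1,
      TendstoInDistribution
        (fun (n : ℕ) (ω : Ω) => √(n : ℝ) *
          modHSIC HX HY (w γ n) (fun i : Fin n => Xs i ω) (fun i : Fin n => Ys i ω))
        atTop (id : ℝ → ℝ) (fun _ => P)
        (gaussianReal 0 (Real.toNNReal
          (4 * (wlim γ ^ 2 - 1) *
            variance (fun ω => funV HX HY P X Y (Xs 0 ω) (Ys 0 ω)) P))) := by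
  have hfc : Continuous (feature HX : 𝒳 → HX) := continuous_feature HX hA2X.1
  have hgc : Continuous (feature HY : 𝒴 → HY) := continuous_feature HY hA2Y.1
  obtain ⟨MX, hMX, hfMX⟩ := exists_norm_feature_le HX hA1X
  obtain ⟨MY, hMY, hgMY⟩ := exists_norm_feature_le HY hA1Y
  have hα : IsProbabilityMeasure (P.map X) := Measure.isProbabilityMeasure_map hX.aemeasurable
  have hβ : IsProbabilityMeasure (P.map Y) := Measure.isProbabilityMeasure_map hY.aemeasurable
  have hm : meanEmb HX P X = ∫ x, feature HX x ∂(P.map X) :=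
    (integral_map hX.aemeasurable hfc.stronglyMeasurable.aestronglyMeasurable).symm
  have hm' : meanEmb HY P Y = ∫ y, feature HY y ∂(P.map Y) :=
    (integral_map hY.aemeasurable hgc.stronglyMeasurable.aestronglyMeasurable).symm
  have hfi : Integrable (feature HX : 𝒳 → HX) (P.map X) :=
    .of_bound hfc.stronglyMeasurable.aestronglyMeasurable MX (Eventually.of_forall hfMX)
  have hgi : Integrable (feature HY : 𝒴 → HY) (P.map Y) :=
    .of_bound hgc.stronglyMeasurable.aestronglyMeasurable MY (Eventually.of_forall hgMY)
  have hmunu : muOp HX HY P X Y = nuOp HX HY P X Y := by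
    have hc : Continuous fun z : 𝒳 × 𝒴 => tensorOp (feature HY z.2) (feature HX z.1) := by
      have h := (InnerProductSpace.rankOne ℝ : HX →L[ℝ] HY →L[ℝ] HY →L[ℝ] HX).continuous.comp
        (hfc.comp (continuous_fst (Y := 𝒴)))
      exact h.clm_apply (g := fun z : 𝒳 × 𝒴 => feature HY z.2) (hgc.comp continuous_snd)
    rw [muOp, nuOp, hm, hm', ← integral_tensorOp_prod hfi hgi, ← hH0,
      integral_map (hX.prodMk hY).aemeasurable hc.stronglyMeasurable.aestronglyMeasurable]
  have hV : ∀ x y, funV HX HY P X Y x y = inner ℝ (feature HX x) (meanEmb HX P X)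
      * inner ℝ (feature HY y) (meanEmb HY P Y) - ‖meanEmb HX P X‖ ^ 2 * ‖meanEmb HY P Y‖ ^ 2 := by
    intro x y
    rw [funV, hmunu, nuOp, hsInner_tensorOp_sub, real_inner_self_eq_norm_sq,
      real_inner_self_eq_norm_sq]
  refine ⟨by simp [hsic, hmunu, hsInner], hmunu, fun x y => by simp [funU, funV, hmunu, hsInner],
    fun γ hγ => ?_⟩
  obtain ⟨τ, -, n₀, hτ⟩ := hA3 γ hγ
  obtain ⟨C, hC0, hC⟩ := hA4
  obtain ⟨hlim, hgt⟩ := hA5 γ hγ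
  simp_rw [hV, modHSIC_eq_featureHSIC]
  exact tendstoInDistribution_featureHSIC (α := P.map X) (β := P.map Y)
    (Z := fun i ω => (Xs i ω, Ys i ω)) (fun i => (hXs i).prodMk (hYs i)) hindep
    (fun i => (hident i).map_eq.trans hH0) hfc.stronglyMeasurable hgc.stronglyMeasurable
    (M := max MX MY) (hMX.trans (le_max_left _ _)) (fun x => (hfMX x).trans (le_max_left _ _))
    (fun y => (hgMY y).trans (le_max_right _ _)) hm hm' (C := max 1 C) (le_max_left _ _)
    (fun n i => by
      rw [abs_of_nonneg (hw γ hγ n i)]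
      exact (hC γ hγ n i).le.trans (le_max_right _ _))
    (eventually_atTop.2 ⟨n₀ + 1, fun n hn => hτ n hn⟩) hgt.le hlim
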